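/- Let $p$ be a prime, let $\mathbf{R}$ be the ring of algebraic integers in $\mathbb{C}$, let $M$ be a maximal ideal of $\mathbf{R}$ with $p\in M$, and put $F=\mathbf{R}/M$ and $\mathcal{O}=\{r/s : r\in\mathbf{R},\ s\in\mathbf{R}\setminus M\}\subseteq\mathbb{C}$, with reduction map ${}^*:\mathcal{O}\to F$, $(r/s)^*=(r+M)/(s+M)$. For a finite group $G$ let $\operatorname{Irr}(G)$ be the set of its irreducible complex characters, $[\chi,\psi]=\frac1{|G|}\sum_{g\in G}\chi(g)\psi(g^{-1})$ for class functions $\chi,\psi$, and $e_\chi=\frac{\chi(1)}{|G|}\sum_{g\in G}\chi(g^{-1})g\in\operatorname{Z}(\mathbb{C}G)$ for $\chi\in\operatorname{Irr}(G)$. A $p$-block $B$ of $G$ is given by its set $\operatorname{Irr}(B)$, an equivalence class of $\operatorname{Irr}(G)$ under the relation: $\chi\sim\psi$ if and only if $\frac{|K|\chi(g)}{\chi(1)}-\frac{|K|\psi(g)}{\psi(1)}\in M$ for every $g\in G$, where $K$ is the conjugacy class of $g$. The element $f_B=\sum_{\chi\in\operatorname{Irr}(B)}e_\chi$ is a central idempotent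 with coefficients in $\mathcal{O}$; let $e_B=f_B^*\in FG$ be obtained by reducing its coefficients. Over $\mathcal{O}$ the algebra of $B$ is $\mathcal{O}Gf_B$ (with identity $f_B$), and over $F$ it is $FGe_B$ (with identity $e_B$). Let $B$ and $B'$ be $p$-blocks of finite groups $G$ and $H$. They are called perfectly isometric if there is a group isomorphism $I:\mathbb{Z}\operatorname{Irr}(B)\to\mathbb{Z}\operatorname{Irr}(B')$ between the groups of generalized characters that preserves the scalar product $[\cdot,\cdot]$ and is such that $\mu_I(g,h)=\sum_{\chi\in\operatorname{Irr}(B)}\chi(g)\,I(\chi)(h)$ satisfies, for all $g\in G$ and $h\in H$: (sep) if exactly one of $g$ and $h$ has order prime to $p$, then $\mu_I(g,h)=0$; (int) $\mu_I(g,h)/|\operatorname{C}_G(g)|_p$ and $\mu_I(g,h)/|\operatorname{C}_H(h)|_p$ are algebraic integers, where $n_p$ denotes the largest power of $p$ dividing $n$. Theorem. If $B$ and $B'$ are perfectly isometric, then $\operatorname{Z}(\mathcal{O}Gf_B)$ and $\operatorname{Z}(\mathcal{O}Hf_{B'})$ are isomorphic as $\mathcal{O}$-algebras, and $\operatorname{Z}(FGe_B)$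 and $\operatorname{Z}(FHe_{B'})$ are isomorphic as $F$-algebras. -/

import Mathlib

namespace PerfectIsometry

open scoped MonoidAlgebra

set_option linter.unusedSectionVars false

section Rings

/-- The ring of algebraic integers in `ℂ`. -/
abbrev AlgInt : Subalgebra ℤ ℂ := integralClosure ℤ ℂ

variable (M : Ideal AlgInt) [M.IsMaximal]

theorem AlgInt.coe_ne_zero {M : Ideal AlgInt} {s : AlgInt} (hs : s ∉ M) : (s : ℂ) ≠ 0 := by
  intro h
  apply hs
  have : s = 0 := Subtype.ext h
  rw [this]
  exact M.zero_mem

/-- The valuation ring `𝒪 = {r / s : r, s algebraic integers, s ∉ M}`, a subring of `ℂ`. -/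
def ValRing : Subring ℂ where
  carrier := {x | ∃ r s : AlgInt, s ∉ M ∧ x = (r : ℂ) / (s : ℂ)}
  one_mem' := ⟨1, 1, (Ideal.ne_top_iff_one M).mp (Ideal.IsMaximal.ne_top ‹_›), by simp⟩
  zero_mem' := ⟨0, 1, (Ideal.ne_top_iff_one M).mp (Ideal.IsMaximal.ne_top ‹_›), by simp⟩
  mul_mem' := by
    rintro _ _ ⟨r, s, hs, rfl⟩ ⟨r', s', hs', rfl⟩
    refine ⟨r * r', s * s', fun h => (Ideal.IsPrime.mem_or_mem inferInstance h).elim hs hs', ?_⟩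
    push_cast
    rw [div_mul_div_comm]
  add_mem' := by
    rintro _ _ ⟨r, s, hs, rfl⟩ ⟨r', s', hs', rfl⟩
    refine ⟨r * s' + s * r', s * s', fun h =>
      (Ideal.IsPrime.mem_or_mem inferInstance h).elim hs hs', ?_⟩
    push_cast
    rw [div_add_div _ _ (AlgInt.coe_ne_zero hs) (AlgInt.coe_ne_zero hs')]
  neg_mem' := by
    rintro _ ⟨r, s, hs, rfl⟩
    exact ⟨-r, s, hs, by push_cast; rw [neg_div]⟩

/-- The residue field `F = 𝐑 / M` of the ring `𝐑` of algebraic integers. -/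
abbrev ResField : Type := AlgInt ⧸ M

theorem mk_ne_zero {M : Ideal AlgInt} {s : AlgInt} (hs : s ∉ M) : Ideal.Quotient.mk M s ≠ 0 :=
  fun h => hs (Ideal.Quotient.eq_zero_iff_mem.mp h)

theorem residue_aux (x : ValRing M) : ∃ y : ResField M, ∀ r s : AlgInt, s ∉ M →
    (x : ℂ) = (r : ℂ) / (s : ℂ) → y * Ideal.Quotient.mk M s = Ideal.Quotient.mk M r := by
  obtain ⟨x, a, b, hb, rfl⟩ := x
  obtain ⟨c, hc⟩ := Ideal.Quotient.exists_inv (mk_ne_zero hb)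
  refine ⟨Ideal.Quotient.mk M a * c, fun r s hs h => ?_⟩
  have h2 : a * s = r * b := by
    apply Subtype.ext
    push_cast
    exact (div_eq_div_iff (AlgInt.coe_ne_zero hb) (AlgInt.coe_ne_zero hs)).mp h
  have h3 := congrArg (Ideal.Quotient.mk M) h2
  rw [map_mul, map_mul] at h3
  rw [mul_right_comm, h3, mul_assoc, hc, mul_one]

/-- The underlying function of the reduction map `𝒪 → F`. -/
noncomputable def residueFun (x : ValRing M) : ResField M := (residue_aux M x).choose

/-- `residueFun (r / s) = (r + M) / (s + M)`. -/
theorem residueFun_mul (x : ValRing M) (r s : AlgInt) (hs : s ∉ M) (h : (x : ℂ) = r / s) :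
    residueFun M x * Ideal.Quotient.mk M s = Ideal.Quotient.mk M r :=
  (residue_aux M x).choose_spec r s hs h

theorem one_notMem : (1 : AlgInt) ∉ M := (Ideal.ne_top_iff_one M).mp (Ideal.IsMaximal.ne_top ‹_›)

theorem mul_notMem {M : Ideal AlgInt} [M.IsMaximal] {s t : AlgInt} (hs : s ∉ M) (ht : t ∉ M) :
    s * t ∉ M :=
  fun h => (Ideal.IsPrime.mem_or_mem inferInstance h).elim hs ht

/-- The reduction map `𝒪 → F`, `r / s ↦ (r + M) / (s + M)`. -/
noncomputable def residue : ValRing M →+* ResField M where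
  toFun := residueFun M
  map_one' := by simpa using residueFun_mul M 1 1 1 (one_notMem M) (by simp)
  map_zero' := by simpa using residueFun_mul M 0 0 1 (one_notMem M) (by simp)
  map_mul' x y := by
    obtain ⟨r, s, hs, h⟩ := x.2
    obtain ⟨r', s', hs', h'⟩ := y.2
    have h1 := residueFun_mul M x r s hs h
    have h2 := residueFun_mul M y r' s' hs' h'
    have h3 := residueFun_mul M (x * y) (r * r') (s * s') (mul_notMem hs hs')
      (by push_cast; rw [h, h', div_mul_div_comm])
    apply mul_right_cancel₀ (mk_ne_zero (mul_notMem hs hs'))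
    rw [h3, map_mul, map_mul, ← h1, ← h2]
    ring
  map_add' x y := by
    obtain ⟨r, s, hs, h⟩ := x.2
    obtain ⟨r', s', hs', h'⟩ := y.2
    have h1 := residueFun_mul M x r s hs h
    have h2 := residueFun_mul M y r' s' hs' h'
    have h3 := residueFun_mul M (x + y) (r * s' + s * r') (s * s') (mul_notMem hs hs')
      (by push_cast
          rw [h, h', div_add_div _ _ (AlgInt.coe_ne_zero hs) (AlgInt.coe_ne_zero hs')])
    apply mul_right_cancel₀ (mk_ne_zero (mul_notMem hs hs'))
    rw [h3, map_add, map_mul, map_mul, map_mul, ← h1, ← h2]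
    ring

theorem mem_valRing_of_isIntegral {x : ℂ} (hx : IsIntegral ℤ x) : x ∈ ValRing M :=
  ⟨⟨x, hx⟩, 1, (Ideal.ne_top_iff_one M).mp (Ideal.IsMaximal.ne_top ‹_›), by simp⟩

end Rings

section Corner

variable {R A : Type*} [CommRing R] [Ring A] [Algebra R A] {e : A}

/-- For an idempotent `e` of an `R`-algebra `A`, the ring `e A e` with identity element `e` is an
`R`-algebra through the scalar multiplication of `A`. -/
noncomputable instance cornerAlgebra (he : IsIdempotentElem e) : Algebra R he.Corner where
  smul r x := ⟨r • x.1, (Subsemigroup.mem_corner_iff he).mpr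
    ⟨by rw [mul_smul_comm, ((Subsemigroup.mem_corner_iff he).mp x.2).1],
      by rw [smul_mul_assoc, ((Subsemigroup.mem_corner_iff he).mp x.2).2]⟩⟩
  algebraMap :=
    { toFun := fun r => ⟨r • e, (Subsemigroup.mem_corner_iff he).mpr
        ⟨by rw [mul_smul_comm, he.eq], by rw [smul_mul_assoc, he.eq]⟩⟩
      map_one' := Subtype.ext (one_smul R e)
      map_zero' := Subtype.ext (zero_smul R e)
      map_mul' := fun r s => Subtype.ext <| by
        change (r * s) • e = (r • e) * (s • e)
        rw [smul_mul_smul_comm, he.eq]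
      map_add' := fun r s => Subtype.ext (add_smul r s e) }
  commutes' r x := Subtype.ext <| by
    change (r • e) * x.1 = x.1 * (r • e)
    rw [smul_mul_assoc, mul_smul_comm, ((Subsemigroup.mem_corner_iff he).mp x.2).1,
      ((Subsemigroup.mem_corner_iff he).mp x.2).2]
  smul_def' r x := Subtype.ext <| by
    change r • x.1 = (r • e) * x.1
    rw [smul_mul_assoc, ((Subsemigroup.mem_corner_iff he).mp x.2).1]

end Corner

section Characters

/-- An irreducible complex character of `G`: the trace function of an irreducible representation
of `G` on some `ℂⁿ`. -/
def IsIrrChar {G : Type*} [Group G] (χ : G → ℂ) : Prop :=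
  ∃ (n : ℕ) (ρ : Representation ℂ G (Fin n → ℂ)), ρ.IsIrreducible ∧ ρ.character = χ

/-- The set `Irr(G)` of irreducible complex characters of `G`. -/
def Irr (G : Type*) [Group G] : Type _ := {χ : G → ℂ // IsIrrChar χ}

instance (G : Type*) [Group G] : CoeFun (Irr G) (fun _ => G → ℂ) := ⟨fun χ => χ.1⟩

variable {G : Type*} [Group G]

theorem isEquiv_isIrreducible {V W : Type*} [AddCommGroup V] [Module ℂ V] [AddCommGroup W]
    [Module ℂ W] {ρ : Representation ℂ G V} {σ : Representation ℂ G W} (φ : ρ.Equiv σ)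
    [h : ρ.IsIrreducible] : σ.IsIrreducible := by
  rw [Representation.irreducible_iff_isSimpleModule_asModule] at h ⊢
  let f := Representation.IntertwiningMap.equivLinearMapAsModule ρ σ φ.toIntertwiningMap
  have hf : Function.Bijective f := φ.toLinearEquiv.bijective
  exact IsSimpleModule.congr (LinearEquiv.ofBijective f hf).symm

theorem isIrrChar_character {V : Type*} [AddCommGroup V] [Module ℂ V] [FiniteDimensional ℂ V]
    (ρ : Representation ℂ G V) [ρ.IsIrreducible] : IsIrrChar ρ.character := by
  let e : V ≃ₗ[ℂ] (Fin (Module.finrank ℂ V) → ℂ) :=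
    (Module.finBasis ℂ V).equivFun
  let σ : Representation ℂ G (Fin (Module.finrank ℂ V) → ℂ) :=
    (e.conjRingEquiv : Module.End ℂ V →* _).comp ρ
  let φ : ρ.Equiv σ := Representation.Equiv.mk e (fun g => by
    ext v; simp [σ, LinearEquiv.conjRingEquiv])
  exact ⟨_, σ, isEquiv_isIrreducible φ, (Representation.char_iso φ).symm⟩

theorem character_one_ne_zero {V : Type*} [AddCommGroup V] [Module ℂ V] [FiniteDimensional ℂ V]
    (ρ : Representation ℂ G V) [ρ.IsIrreducible] : ρ.character 1 ≠ 0 := by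
  rw [Representation.char_one]
  have := (Representation.irreducible_iff_isSimpleModule_asModule ρ).mp inferInstance
  have : Nontrivial V := IsSimpleModule.nontrivial ℂ[G] ρ.asModule
  exact_mod_cast (Module.finrank_pos (R := ℂ) (M := V)).ne'

variable [Fintype G]

/-- The usual scalar product `[χ, ψ] = |G|⁻¹ ∑ χ(g) ψ(g⁻¹)` of class functions. -/
noncomputable def scalarProduct (χ ψ : G → ℂ) : ℂ :=
  (Nat.card G : ℂ)⁻¹ * ∑ g : G, χ g * ψ g⁻¹

/-- The primitive central idempotent `e_χ = (χ(1) / |G|) ∑ χ(g⁻¹) g` of `ℂ[G]`. -/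
noncomputable def centralIdem (χ : Irr G) : ℂ[G] :=
  ∑ g : G, MonoidAlgebra.single g (χ 1 / (Nat.card G : ℂ) * χ g⁻¹)

/-- The sum in `ℂ[G]` of the elements of the conjugacy class of `g`. -/
noncomputable def classSum (g : G) : ℂ[G] :=
  ∑ x ∈ (conjugatesOf g).toFinite.toFinset, MonoidAlgebra.single x 1

/-- The central character `ω_χ`, on all of `ℂ[G]`: `ω_χ(x) = χ(x) / χ(1)` where `χ` is extended
linearly. -/
noncomputable def omega (χ : Irr G) (x : ℂ[G]) : ℂ := (∑ g : G, x.coeff g * χ g) / χ 1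

theorem finite_character_sum {V : Type*} [AddCommGroup V] [Module ℂ V] [FiniteDimensional ℂ V]
    (ρ : Representation ℂ G V) (x : ℂ[G]) :
    LinearMap.trace ℂ V (ρ.asAlgebraHom x) = ∑ g : G, x.coeff g * ρ.character g := by
  rw [Representation.asAlgebraHom_def, MonoidAlgebra.lift_apply,
    Finsupp.sum_fintype _ _ (by simp), map_sum]
  simp [Representation.character]

theorem asAlgebraHom_eq {V : Type*} [AddCommGroup V] [Module ℂ V] [FiniteDimensional ℂ V]
    (ρ : Representation ℂ G V) [ρ.IsIrreducible] {x : ℂ[G]} (hx : x ∈ Subalgebra.center ℂ ℂ[G]) :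
    ρ.asAlgebraHom x = ((∑ g : G, x.coeff g * ρ.character g) / ρ.character 1) • 1 := by
  obtain ⟨c, hc⟩ :=
    Representation.IsIrreducible.algebraMap_intertwiningMap_bijective_of_isAlgClosed.2
      (Representation.IntertwiningMap.centralAlgebraMul (ρ := ρ) hx)
  have h1 : ρ.asAlgebraHom x = c • 1 := by
    ext v
    exact congrArg (fun f : Representation.IntertwiningMap ρ ρ => f v) hc.symm
  have h2 := finite_character_sum ρ x
  rw [h1, map_smul, LinearMap.trace_one, smul_eq_mul, ← Representation.char_one ρ] at h2
  rw [h1, ← h2, mul_div_assoc, div_self (character_one_ne_zero ρ), mul_one]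

/-- An irreducible character comes from a representation on which central elements act through
its central character. -/
theorem exists_rep (χ : Irr G) : ∃ (n : ℕ) (ρ : Representation ℂ G (Fin n → ℂ)),
    ρ.IsIrreducible ∧ ρ.character = χ.1 ∧ Nontrivial (Fin n → ℂ) ∧
    ∀ x ∈ Subalgebra.center ℂ ℂ[G], ρ.asAlgebraHom x = algebraMap ℂ _ (omega χ x) := by
  obtain ⟨n, ρ, hρ, h⟩ := χ.2
  have := (Representation.irreducible_iff_isSimpleModule_asModule ρ).mp inferInstance
  refine ⟨n, ρ, hρ, h, IsSimpleModule.nontrivial ℂ[G] ρ.asModule, fun x hx => ?_⟩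
  rw [asAlgebraHom_eq ρ hx, h, Algebra.algebraMap_eq_smul_one]
  rfl

/-- The central character as a ring homomorphism on the centre of `ℂ[G]`. -/
noncomputable def omegaHom (χ : Irr G) : Subalgebra.center ℂ ℂ[G] →+* ℂ where
  toFun x := omega χ x.1
  map_one' := by
    obtain ⟨n, ρ, _, _, _, h⟩ := exists_rep χ
    apply FaithfulSMul.algebraMap_injective ℂ (Module.End ℂ (Fin n → ℂ))
    rw [← h _ (1 : Subalgebra.center ℂ ℂ[G]).2]
    simp
  map_mul' x y := by
    obtain ⟨n, ρ, _, _, _, h⟩ := exists_rep χ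
    apply FaithfulSMul.algebraMap_injective ℂ (Module.End ℂ (Fin n → ℂ))
    rw [map_mul, ← h _ (x * y).2, ← h _ x.2, ← h _ y.2, ← map_mul]
    rfl
  map_zero' := by simp [omega]
  map_add' x y := by simp [omega, add_mul, Finset.sum_add_distrib, add_div]

theorem omegaHom_algebraMap (χ : Irr G) (c : ℂ) :
    omegaHom χ (algebraMap ℂ (Subalgebra.center ℂ ℂ[G]) c) = c := by
  have h1 : omegaHom χ (c • (1 : Subalgebra.center ℂ ℂ[G])) = c * omegaHom χ 1 := by
    change omega χ (c • (1 : ℂ[G])) = c * omega χ 1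
    simp only [omega, ← mul_div_assoc, Finset.mul_sum, MonoidAlgebra.coeff_smul,
      Finsupp.smul_apply, smul_eq_mul, mul_assoc]
  rw [Algebra.algebraMap_eq_smul_one, h1, map_one, mul_one]

theorem ofModule'_asAlgebraHom (N : Type*) [AddCommGroup N] [Module ℂ N] [Module ℂ[G] N]
    [IsScalarTower ℂ ℂ[G] N] (r : ℂ[G]) (v : N) :
    (Representation.ofModule' (k := ℂ) (G := G) N).asAlgebraHom r v = r • v := by
  induction r using MonoidAlgebra.induction_linear with
  | zero => simp
  | add a b ha hb => rw [map_add, LinearMap.add_apply, ha, hb, add_smul]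
  | single g c =>
    rw [Representation.asAlgebraHom_single, LinearMap.smul_apply]
    have : MonoidAlgebra.single g c = c • (MonoidAlgebra.single g 1 : ℂ[G]) := by simp
    rw [this, smul_assoc]
    rfl

theorem smul_eq_zero_of_omega {x : ℂ[G]} (hx : x ∈ Subalgebra.center ℂ ℂ[G])
    (h : ∀ χ : Irr G, omega χ x = 0) (N : Type*) [AddCommGroup N] [Module ℂ N] [Module ℂ[G] N]
    [IsScalarTower ℂ ℂ[G] N] [FiniteDimensional ℂ N] [IsSimpleModule ℂ[G] N] (v : N) :
    x • v = 0 := by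
  let ρ : Representation ℂ G N := Representation.ofModule' N
  let e : ρ.asModule ≃ₗ[ℂ[G]] N :=
    { ρ.asModuleEquiv with
      map_smul' := fun r w => by
        refine Eq.trans ?_ (ofModule'_asAlgebraHom N r (ρ.asModuleEquiv w))
        exact Representation.asModuleEquiv_map_smul ρ r w }
  have hirr : ρ.IsIrreducible :=
    (Representation.irreducible_iff_isSimpleModule_asModule ρ).mpr (IsSimpleModule.congr e)
  have h1 := asAlgebraHom_eq ρ hx
  have h2 : (∑ g : G, x.coeff g * ρ.character g) / ρ.character 1 = 0 :=
    h ⟨_, isIrrChar_character ρ⟩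
  rw [h2, zero_smul] at h1
  rw [← ofModule'_asAlgebraHom, h1, LinearMap.zero_apply]

theorem eq_zero_of_omega {x : ℂ[G]} (hx : x ∈ Subalgebra.center ℂ ℂ[G])
    (h : ∀ χ : Irr G, omega χ x = 0) : x = 0 := by
  have key : ∀ m : Submodule ℂ[G] ℂ[G], IsSimpleModule ℂ[G] m → ∀ v ∈ m, x * v = 0 := by
    intro m hm v hv
    exact congrArg Subtype.val (smul_eq_zero_of_omega hx h m ⟨v, hv⟩)
  have : NeZero (Nat.card G : ℂ) := ⟨by exact_mod_cast Nat.card_pos.ne'⟩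
  have htop := IsSemisimpleModule.sSup_simples_eq_top ℂ[G] ℂ[G]
  have hall : ∀ v ∈ sSup {m : Submodule ℂ[G] ℂ[G] | IsSimpleModule ℂ[G] m}, x * v = 0 := by
    intro v hv
    rw [sSup_eq_iSup'] at hv
    induction hv using Submodule.iSup_induction' with
    | mem m v hv => exact key m.1 m.2 v hv
    | zero => simp
    | add a b _ _ ha hb => rw [mul_add, ha, hb, add_zero]
  have := hall 1 (by rw [htop]; trivial)
  simpa using this

theorem mem_center_of_conj {R : Type*} [CommRing R] {x : R[G]}
    (h : ∀ g k : G, x.coeff (k * g * k⁻¹) = x.coeff g) : x ∈ Subalgebra.center R R[G] := by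
  rw [Subalgebra.mem_center_iff]
  intro b
  induction b using MonoidAlgebra.induction_linear with
  | zero => simp
  | add a b ha hb => rw [add_mul, mul_add, ha, hb]
  | single k r =>
    ext g
    rw [MonoidAlgebra.coeff_single_mul_apply, MonoidAlgebra.coeff_mul_single_apply, mul_comm]
    congr 1
    rw [← h (k⁻¹ * g) k]
    congr 1
    group

theorem coeff_sum_single (f : G → ℂ) (s : Finset G) (g : G) [Decidable (g ∈ s)] :
    (∑ x ∈ s, MonoidAlgebra.single x (f x) : ℂ[G]).coeff g = if g ∈ s then f g else 0 := by
  classical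
  simp [Finsupp.single_apply]

theorem coeff_centralIdem (χ : Irr G) (g : G) :
    (centralIdem χ).coeff g = χ 1 / (Nat.card G : ℂ) * χ g⁻¹ := by
  classical
  rw [centralIdem, coeff_sum_single (fun g => χ 1 / (Nat.card G : ℂ) * χ g⁻¹)]
  simp

theorem coeff_classSum (g x : G) [Decidable (IsConj g x)] :
    (classSum g).coeff x = if IsConj g x then 1 else 0 := by
  classical
  rw [classSum, coeff_sum_single (fun _ => 1)]
  simp [conjugatesOf]

theorem irr_conj (χ : Irr G) (g k : G) : χ (k * g * k⁻¹) = χ g := by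
  obtain ⟨n, ρ, _, h⟩ := χ.2
  rw [← h, Representation.char_conj]

theorem coeff_centralIdem_conj (χ : Irr G) (g k : G) :
    (centralIdem χ).coeff (k * g * k⁻¹) = (centralIdem χ).coeff g := by
  rw [coeff_centralIdem, coeff_centralIdem, ← irr_conj χ g⁻¹ k]
  simp only [mul_inv_rev, inv_inv, mul_assoc]

theorem centralIdem_mem_center (χ : Irr G) : centralIdem χ ∈ Subalgebra.center ℂ ℂ[G] :=
  mem_center_of_conj (coeff_centralIdem_conj χ)

theorem classSum_mem_center (g : G) : classSum g ∈ Subalgebra.center ℂ ℂ[G] := by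
  classical
  apply mem_center_of_conj
  intro x k
  rw [coeff_classSum, coeff_classSum]
  have : IsConj x (k * x * k⁻¹) := isConj_iff.mpr ⟨k, rfl⟩
  have : IsConj g (k * x * k⁻¹) ↔ IsConj g x := ⟨fun h => h.trans this.symm, fun h => h.trans this⟩
  simp only [this]

theorem irr_one_ne_zero (χ : Irr G) : χ 1 ≠ 0 := by
  obtain ⟨n, ρ, _, h⟩ := χ.2
  rw [← h]
  exact character_one_ne_zero ρ

theorem scalarProduct_irr (χ ψ : Irr G) [Decidable (χ = ψ)] :
    scalarProduct χ.1 ψ.1 = if χ = ψ then 1 else 0 := by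
  classical
  have : Invertible (Nat.card G : ℂ) := invertibleOfNonzero (by exact_mod_cast Nat.card_pos.ne')
  split_ifs with h
  · subst h
    obtain ⟨n, ρ, _, h⟩ := χ.2
    rw [scalarProduct, ← h, Representation.char_orthonormal ρ ρ,
      if_pos ⟨Representation.Equiv.refl ρ⟩]
  · obtain ⟨n, ρ, _, h1⟩ := χ.2
    obtain ⟨m, σ, _, h2⟩ := ψ.2
    rw [scalarProduct, ← h1, ← h2, Representation.char_orthonormal ρ σ, if_neg]
    rintro ⟨φ⟩
    exact h (Subtype.ext (by rw [← h1, ← h2, Representation.char_iso φ]))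

theorem omega_centralIdem (χ ψ : Irr G) [Decidable (ψ = χ)] :
    omega ψ (centralIdem χ) = if ψ = χ then 1 else 0 := by
  have h := scalarProduct_irr ψ χ
  have h2 : omega ψ (centralIdem χ) = χ 1 / ψ 1 * scalarProduct ψ.1 χ.1 := by
    simp only [omega, coeff_centralIdem, scalarProduct, Finset.mul_sum, Finset.sum_div]
    refine Finset.sum_congr rfl fun g _ => ?_
    ring
  rw [h2, h]
  split_ifs with h3
  · rw [h3, div_self (irr_one_ne_zero χ), mul_one]
  · simp

instance : Finite (Irr G) := by
  classical
  have : LinearIndependent ℂ (fun χ : Irr G => χ.1) := by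
    rw [linearIndependent_iff']
    intro s c hc χ hχ
    have h1 : scalarProduct (∑ ψ ∈ s, c ψ • ψ.1) χ.1 = 0 := by rw [hc]; simp [scalarProduct]
    have h2 : scalarProduct (∑ ψ ∈ s, c ψ • ψ.1) χ.1 = ∑ ψ ∈ s, c ψ * scalarProduct ψ.1 χ.1 := by
      simp only [scalarProduct, Finset.sum_apply, Pi.smul_apply, smul_eq_mul, Finset.mul_sum,
        Finset.sum_mul]
      rw [Finset.sum_comm]
      refine Finset.sum_congr rfl fun ψ _ => Finset.sum_congr rfl fun g _ => by ring
    rw [h2] at h1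
    simpa [scalarProduct_irr, hχ] using h1
  exact this.finite

theorem isIntegral_omega_classSum (χ : Irr G) (g : G) : IsIntegral ℤ (omega χ (classSum g)) := by
  classical
  obtain ⟨n, ρ, _, _, _, h⟩ := exists_rep χ
  rw [← isIntegral_algebraMap_iff (FaithfulSMul.algebraMap_injective ℂ
    (Module.End ℂ (Fin n → ℂ))), ← h _ (classSum_mem_center g)]
  have h1 : classSum g = MonoidAlgebra.mapRingHom G (Int.castRingHom ℂ)
      (∑ x ∈ (conjugatesOf g).toFinite.toFinset, MonoidAlgebra.single x 1) := by
    simp [classSum]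
  have : Module.Finite ℤ (MonoidAlgebra ℤ G) := inferInstance
  have h2 : IsIntegral ℤ (∑ x ∈ (conjugatesOf g).toFinite.toFinset,
      MonoidAlgebra.single x 1 : MonoidAlgebra ℤ G) := IsIntegral.of_finite ℤ _
  rw [h1]
  exact (h2.map (MonoidAlgebra.mapRingHom G (Int.castRingHom ℂ)).toIntAlgHom).map
    (ρ.asAlgebraHom.toRingHom.toIntAlgHom)

end Characters

section Blocks

variable (M : Ideal AlgInt) [M.IsMaximal] {G : Type*} [Group G] [Fintype G]

/-- Two irreducible characters lie in the same block if their central characters agree modulo `M`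
on all class sums. -/
def SameBlock (χ ψ : Irr G) : Prop :=
  ∀ g : G, ∃ m : AlgInt, m ∈ M ∧ (m : ℂ) = omega χ (classSum g) - omega ψ (classSum g)

variable (G) in
/-- A `p`-block of `G`, given by its set `Irr(B)` of irreducible characters: a class of characters
whose central characters agree modulo `M`, where `M` is a maximal ideal lying over `p`. -/
structure Block where
  /-- The set `Irr(B)`. -/
  irr : Finset (Irr G)
  exists_mem_iff : ∃ χ : Irr G, ∀ ψ : Irr G, ψ ∈ irr ↔ SameBlock M χ ψ

variable {M}

theorem exists_notMem_of_sub {a : AlgInt} (ha : a ∉ M) {c d : ℂ} (hc : (a : ℂ) = c)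
    (h : ∃ m : AlgInt, m ∈ M ∧ (m : ℂ) = c - d) : ∃ s : AlgInt, s ∉ M ∧ (s : ℂ) = d := by
  obtain ⟨m, hm, h⟩ := h
  refine ⟨a - m, fun h' => ha ?_, by push_cast; rw [h, hc]; ring⟩
  have := M.add_mem h' hm
  rwa [sub_add_cancel] at this

/-- The elements of `ℂ[G]` with coefficients in `𝒪`. -/
theorem mem_range_iff (x : ℂ[G]) :
    x ∈ (MonoidAlgebra.mapRingHom G (ValRing M).subtype).range ↔ ∀ g, x.coeff g ∈ ValRing M := by
  constructor
  · rintro ⟨y, rfl⟩ g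
    rw [MonoidAlgebra.coeff_mapRingHom]
    exact (y.coeff g).2
  · intro h
    refine ⟨∑ g : G, MonoidAlgebra.single g ⟨x.coeff g, h g⟩, ?_⟩
    classical
    ext g
    simp

theorem exists_separating {χ₀ ψ : Irr G} (h : ¬ SameBlock M χ₀ ψ) :
    ∃ y : Subalgebra.center ℂ ℂ[G],
      (y : ℂ[G]) ∈ (MonoidAlgebra.mapRingHom G (ValRing M).subtype).range ∧
      omegaHom ψ y = 0 ∧ ∀ χ, SameBlock M χ₀ χ → ∃ s : AlgInt, s ∉ M ∧ (s : ℂ) = omegaHom χ y := by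
  classical
  simp only [SameBlock, not_forall] at h
  obtain ⟨g, hg⟩ := h
  set c := omega ψ (classSum g) with hc
  have hci : IsIntegral ℤ c := isIntegral_omega_classSum ψ g
  let k : Subalgebra.center ℂ ℂ[G] := ⟨classSum g, classSum_mem_center g⟩
  have hk : ∀ χ, omegaHom χ (k - algebraMap ℂ _ c) = omega χ (classSum g) - c := by
    intro χ
    rw [map_sub]
    congr 1
    exact omegaHom_algebraMap χ c
  refine ⟨k - algebraMap ℂ _ c, ?_, ?_, ?_⟩
  · rw [mem_range_iff]
    intro x
    change (classSum g - algebraMap ℂ ℂ[G] c).coeff x ∈ ValRing M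
    have : (algebraMap ℂ ℂ[G] c).coeff x = if x = 1 then c else 0 := by
      simp [Finsupp.single_apply, eq_comm]
    rw [MonoidAlgebra.coeff_sub, Finsupp.sub_apply, coeff_classSum, this]
    refine sub_mem ?_ ?_
    · split_ifs
      exacts [one_mem _, zero_mem _]
    · split_ifs
      exacts [mem_valRing_of_isIntegral M hci, zero_mem _]
  · rw [hk, ← hc, sub_self]
  · intro χ hχ
    rw [hk]
    have hai : IsIntegral ℤ (omega χ₀ (classSum g) - c) :=
      (isIntegral_omega_classSum χ₀ g).sub hci
    refine exists_notMem_of_sub (M := M) (a := ⟨_, hai⟩) (c := omega χ₀ (classSum g) - c)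
      (fun hm => hg ⟨_, hm, rfl⟩) rfl ?_
    obtain ⟨m, hm, h⟩ := hχ g
    exact ⟨m, hm, by rw [h]; ring⟩

/-- The block idempotent `∑ e_χ`, `χ ∈ Irr(B)`, as an element of `ℂ[G]`. -/
noncomputable def Block.sumIdem (B : Block M G) : ℂ[G] := ∑ χ ∈ B.irr, centralIdem χ

theorem Block.sumIdem_mem_center (B : Block M G) : B.sumIdem ∈ Subalgebra.center ℂ ℂ[G] :=
  sum_mem fun χ _ => centralIdem_mem_center χ

theorem Block.omega_sumIdem (B : Block M G) (ψ : Irr G) [Decidable (ψ ∈ B.irr)] :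
    omega ψ B.sumIdem = if ψ ∈ B.irr then 1 else 0 := by
  classical
  have : omega ψ B.sumIdem = ∑ χ ∈ B.irr, omega ψ (centralIdem χ) := by
    change omegaHom ψ ⟨B.sumIdem, B.sumIdem_mem_center⟩ =
      ∑ χ ∈ B.irr, omegaHom ψ ⟨centralIdem χ, centralIdem_mem_center χ⟩
    rw [← map_sum]
    congr 1
    apply Subtype.ext
    simp [sumIdem]
  rw [this]
  simp [omega_centralIdem]

theorem Block.sumIdem_isIdempotentElem (B : Block M G) : IsIdempotentElem B.sumIdem := by
  classical
  rw [IsIdempotentElem, ← sub_eq_zero]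
  let f : Subalgebra.center ℂ ℂ[G] := ⟨B.sumIdem, B.sumIdem_mem_center⟩
  refine eq_zero_of_omega (f * f - f).2 fun ψ => ?_
  have h : omegaHom ψ f = if ψ ∈ B.irr then 1 else 0 := B.omega_sumIdem ψ
  change omegaHom ψ (f * f - f) = 0
  rw [map_sub, map_mul, h]
  split_ifs <;> simp

/-- The block idempotent of a block has coefficients in `𝒪`. -/
theorem Block.sumIdem_mem_range (B : Block M G) :
    B.sumIdem ∈ (MonoidAlgebra.mapRingHom G (ValRing M).subtype).range := by
  classical
  have : Fintype (Irr G) := Fintype.ofFinite _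
  obtain ⟨χ₀, hB⟩ := B.exists_mem_iff
  let S : Subring (Subalgebra.center ℂ ℂ[G]) :=
    ((MonoidAlgebra.mapRingHom G (ValRing M).subtype).range).comap
      (Subalgebra.center ℂ ℂ[G]).val.toRingHom
  have hS : ∀ c ∈ ValRing M, algebraMap ℂ (Subalgebra.center ℂ ℂ[G]) c ∈ S := by
    intro c hc
    change algebraMap ℂ ℂ[G] c ∈ (MonoidAlgebra.mapRingHom G (ValRing M).subtype).range
    rw [mem_range_iff]
    intro x
    have : (algebraMap ℂ ℂ[G] c).coeff x = if x = 1 then c else 0 := by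
      simp [Finsupp.single_apply, eq_comm]
    rw [this]
    split_ifs
    exacts [hc, zero_mem _]
  have hy : ∀ ψ : Irr G, ∃ y : Subalgebra.center ℂ ℂ[G], ψ ∉ B.irr → y ∈ S ∧
      omegaHom ψ y = 0 ∧ ∀ χ ∈ B.irr, ∃ s : AlgInt, s ∉ M ∧ (s : ℂ) = omegaHom χ y := by
    intro ψ
    by_cases hψ : ψ ∈ B.irr
    · exact ⟨0, fun h => absurd hψ h⟩
    · obtain ⟨y, h1, h2, h3⟩ := exists_separating (fun h => hψ ((hB ψ).mpr h))
      exact ⟨y, fun _ => ⟨h1, h2, fun χ hχ => h3 χ ((hB χ).mp hχ)⟩⟩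
  choose y hy using hy
  let u : Subalgebra.center ℂ ℂ[G] := ∏ ψ ∈ B.irrᶜ, y ψ
  have huS : u ∈ S := prod_mem fun ψ hψ => (hy ψ (Finset.mem_compl.mp hψ)).1
  have hu0 : ∀ ψ ∉ B.irr, omegaHom ψ u = 0 := fun ψ hψ => by
    rw [map_prod]
    exact Finset.prod_eq_zero (Finset.mem_compl.mpr hψ) (hy ψ hψ).2.1
  have hprod : ∀ (ι : Type _) (s : Finset ι) (f : ι → ℂ),
      (∀ i ∈ s, ∃ a : AlgInt, a ∉ M ∧ (a : ℂ) = f i) →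
      ∃ a : AlgInt, a ∉ M ∧ (a : ℂ) = ∏ i ∈ s, f i := by
    intro ι s f
    induction s using Finset.induction_on with
    | empty => exact fun _ => ⟨1, one_notMem M, by simp⟩
    | insert i s hi ih =>
      intro h
      obtain ⟨a, ha, ha'⟩ := h i (Finset.mem_insert_self i s)
      obtain ⟨b, hb, hb'⟩ := ih fun j hj => h j (Finset.mem_insert_of_mem hj)
      exact ⟨a * b, mul_notMem ha hb, by rw [Finset.prod_insert hi, ← ha', ← hb']; rfl⟩
  have hu1 : ∀ χ ∈ B.irr, ∃ s : AlgInt, s ∉ M ∧ (s : ℂ) = omegaHom χ u := fun χ hχ => by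
    rw [map_prod]
    exact hprod _ _ _ fun ψ hψ => (hy ψ (Finset.mem_compl.mp hψ)).2.2 χ hχ
  obtain ⟨t, ht, ht'⟩ := hprod _ B.irr (fun χ => omegaHom χ u) hu1
  let Q : Subalgebra.center ℂ ℂ[G] := ∏ χ ∈ B.irr, (algebraMap ℂ _ (omegaHom χ u) - u)
  have hQS : Q ∈ S := prod_mem fun χ hχ => sub_mem (hS _ (by
    obtain ⟨s, _, hs⟩ := hu1 χ hχ
    rw [← hs]
    exact mem_valRing_of_isIntegral M s.2)) huS
  have hti : (t : ℂ)⁻¹ ∈ ValRing M := ⟨1, t, ht, by simp⟩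
  let f : Subalgebra.center ℂ ℂ[G] := 1 - algebraMap ℂ _ (t : ℂ)⁻¹ * Q
  have hfS : f ∈ S := sub_mem (one_mem _) (mul_mem (hS _ hti) hQS)
  have hf : f.1 = B.sumIdem := by
    rw [← sub_eq_zero]
    let e : Subalgebra.center ℂ ℂ[G] := ⟨B.sumIdem, B.sumIdem_mem_center⟩
    refine eq_zero_of_omega (f - e).2 fun ψ => ?_
    have h : omegaHom ψ e = if ψ ∈ B.irr then 1 else 0 := B.omega_sumIdem ψ
    change omegaHom ψ (f - e) = 0
    rw [map_sub, h, map_sub, map_mul, map_one, omegaHom_algebraMap, map_prod]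
    simp only [map_sub, omegaHom_algebraMap]
    split_ifs with hψ
    · rw [Finset.prod_eq_zero hψ (sub_self _)]
      simp
    · simp only [hu0 ψ hψ, sub_zero]
      rw [← ht', inv_mul_cancel₀ (AlgInt.coe_ne_zero ht), sub_self]
  rw [← hf]
  exact hfS

/-- The block idempotent `f_B ∈ 𝒪[G]` of `B`: the element that becomes `∑ e_χ`, `χ ∈ Irr(B)`,
in `ℂ[G]`. -/
noncomputable def Block.idem (B : Block M G) : (ValRing M)[G] := B.sumIdem_mem_range.choose

theorem Block.map_idem (B : Block M G) :
    MonoidAlgebra.mapRingHom G (ValRing M).subtype B.idem = ∑ χ ∈ B.irr, centralIdem χ :=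
  B.sumIdem_mem_range.choose_spec

theorem Block.idem_isIdempotentElem (B : Block M G) : IsIdempotentElem B.idem := by
  have hinj : Function.Injective (MonoidAlgebra.mapRingHom G (ValRing M).subtype) := by
    intro a b h
    ext g
    have := congrArg (fun z => z.coeff g) h
    simpa using this
  apply hinj
  rw [map_mul, B.map_idem]
  exact B.sumIdem_isIdempotentElem

theorem Block.coeff_idem_conj (B : Block M G) (g k : G) :
    B.idem.coeff (k * g * k⁻¹) = B.idem.coeff g := by
  apply Subtype.ext
  have h : ∀ x : G, (B.idem.coeff x : ℂ) = ∑ χ ∈ B.irr, (centralIdem χ).coeff x := by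
    intro x
    have := congrArg (fun z => z.coeff x) B.map_idem
    simpa [Finsupp.finsetSum_apply] using this
  rw [h, h]
  exact Finset.sum_congr rfl fun χ _ => coeff_centralIdem_conj χ g k

/-- `f_B` is central in `𝒪[G]`. -/
theorem Block.idem_mem_center (B : Block M G) :
    B.idem ∈ Subalgebra.center (ValRing M) (ValRing M)[G] :=
  mem_center_of_conj B.coeff_idem_conj

/-- The reduction `e_B ∈ F[G]` of the block idempotent. -/
noncomputable def Block.idemF (B : Block M G) : (ResField M)[G] :=
  MonoidAlgebra.mapRingHom G (residue M) B.idem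

theorem Block.idemF_isIdempotentElem (B : Block M G) : IsIdempotentElem B.idemF :=
  B.idem_isIdempotentElem.map _

/-- `e_B` is central in `F[G]`. -/
theorem Block.idemF_mem_center (B : Block M G) :
    B.idemF ∈ Subalgebra.center (ResField M) (ResField M)[G] :=
  mem_center_of_conj fun g k => by
    rw [idemF, MonoidAlgebra.coeff_mapRingHom, MonoidAlgebra.coeff_mapRingHom, B.coeff_idem_conj]

/-- The block algebra `𝒪 G f_B`. As `f_B` is central, it equals `f_B 𝒪 G f_B`. -/
abbrev Block.Alg (B : Block M G) : Type _ := B.idem_isIdempotentElem.Corner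

/-- The block algebra `F G e_B`. As `e_B` is central, it equals `e_B F G e_B`. -/
abbrev Block.AlgF (B : Block M G) : Type _ := B.idemF_isIdempotentElem.Corner

/-- The centre of the block algebra over `𝒪`. -/
noncomputable abbrev Block.centre (B : Block M G) : Subalgebra (ValRing M) B.Alg :=
  Subalgebra.center (ValRing M) B.Alg

/-- The centre of the block algebra over `F`. -/
noncomputable abbrev Block.centreF (B : Block M G) : Subalgebra (ResField M) B.AlgF :=
  Subalgebra.center (ResField M) B.AlgF

end Blocks

section PerfectIsometries

variable {M : Ideal AlgInt} [M.IsMaximal] {G H : Type*} [Group G] [Fintype G]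
  [Group H] [Fintype H]

/-- The group `ℤ Irr(B)` of generalized characters of the block `B`. -/
def Block.genChar (B : Block M G) : AddSubgroup (G → ℂ) :=
  AddSubgroup.closure {f | ∃ χ ∈ B.irr, χ.1 = f}

theorem Block.mem_genChar (B : Block M G) {χ : Irr G} (hχ : χ ∈ B.irr) : χ.1 ∈ B.genChar :=
  AddSubgroup.subset_closure ⟨χ, hχ, rfl⟩

/-- `μ_I(g, h) = ∑ χ(g) I(χ)(h)`, the sum over `χ ∈ Irr(B)`. -/
noncomputable def mu {B : Block M G} {B' : Block M H} (I : B.genChar ≃+ B'.genChar)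
    (g : G) (h : H) : ℂ :=
  ∑ χ : {χ : Irr G // χ ∈ B.irr}, χ.1 g * (I ⟨χ.1.1, B.mem_genChar χ.2⟩).1 h

/-- An element of a finite group is `p`-regular if `p` does not divide its order. -/
def PRegular {K : Type*} [Group K] (p : ℕ) (g : K) : Prop := ¬ p ∣ orderOf g

/-- The `p`-part `|C_K(g)|_p` of the order of the centralizer of `g`. -/
noncomputable def centralizerPPart {K : Type*} [Group K] (p : ℕ) (g : K) : ℕ :=
  p ^ (Nat.card (Subgroup.centralizer {g})).factorization p

/-- `I : ℤ Irr(B) → ℤ Irr(B')` is a perfect isometry. -/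
structure IsPerfectIsometry (p : ℕ) {B : Block M G} {B' : Block M H}
    (I : B.genChar ≃+ B'.genChar) : Prop where
  isometry : ∀ x y, scalarProduct (I x).1 (I y).1 = scalarProduct x.1 y.1
  sep : ∀ g h, Xor (PRegular p g) (PRegular p h) → mu I g h = 0
  int_left : ∀ g h, IsIntegral ℤ (mu I g h / (centralizerPPart p g : ℂ))
  int_right : ∀ g h, IsIntegral ℤ (mu I g h / (centralizerPPart p h : ℂ))

/-- `B` and `B'` are perfectly isometric. -/
def PerfectlyIsometric (p : ℕ) (B : Block M G) (B' : Block M H) : Prop :=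
  ∃ I : B.genChar ≃+ B'.genChar, IsPerfectIsometry p I

end PerfectIsometries

end PerfectIsometry

/-! An element `z` of `Z(𝒪Gf_B)` is determined by the values `v_χ = ω_χ(z)` for `χ ∈ Irr(B)`, since
in `ℂG` it equals `∑ v_χ e_χ`. Hence the centre is a subalgebra of `ℂ^Irr(B)`, namely the set of all
`v` for which the class function `∑ v_χ (χ(1)/|G|) χ` has values in `𝒪` (`Block.coords`,
`Block.mem_range_coords_iff`).

An isometry `I` sends each `χ ∈ Irr(B)` to `e_χ s(χ)` with a sign `e_χ` and a bijection `s`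
(`exists_signed_bijection`). Extended linearly, it sends a class function `f` of the block to `h ↦
|G|⁻¹ ∑ μ(g⁻¹, h) f(g)`. Summed over conjugacy classes, this involves only the quotients `μ(g⁻¹,
h)/|C_G(g)|`. They lie in `𝒪` by (int), because the `p'`-part of `|C_G(g)|` is invertible there. So
`𝒪`-valued functions go to `𝒪`-valued functions (`transfer_mem_range`), and the same holds for
`I⁻¹`.

In coordinates this map is not multiplicative: besides permuting, it multiplies by `e_χ
(χ(1)/|G|)/(s(χ)(1)/|H|)`. The map of `I⁻¹`, applied to the identity of the other block, produces an
element of `Z(𝒪Gf_B)` whose coordinates are the inverses of these factors. Multiplying by it before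
transferring leaves the bare permutation `v ↦ v ∘ s⁻¹`, which is an algebra map
(`comp_symm_mem_range`). By symmetry it carries one centre onto the other.

Over `F`, reduction of coefficients maps `Z(𝒪Gf_B)` onto `Z(FGe_B)`, and its kernel is generated by
scalars from the kernel of `𝒪 → F`. Every isomorphism over `𝒪` respects such a kernel and so
descends to `F` (`nonempty_centreF_algEquiv`). -/

namespace PerfectIsometry

set_option linter.unusedSectionVars false

open scoped MonoidAlgebra

/-! ### Averages of class functions -/

section ClassFunctions

theorem centralizer_inv_singleton {G : Type*} [Group G] (g : G) :
    Subgroup.centralizer {g⁻¹} = Subgroup.centralizer {g} := by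
  ext x
  simp only [Subgroup.mem_centralizer_singleton_iff]
  exact (Commute.inv_right_iff (a := x) (b := g))

variable {G : Type*} [Group G] [Fintype G]

/-- A conjugacy class `K` of `g` contributes `|K| φ(g) / |G| = φ(g) / |C_G(g)|` to the average. This
is how divisibility by centralizer orders turns into integrality. -/
theorem sum_div_card_mem {S : Subring ℂ} (φ : G → ℂ) (hφ : ∀ g k, φ (k * g * k⁻¹) = φ g)
    (hS : ∀ g, φ g / (Nat.card (Subgroup.centralizer {g}) : ℂ) ∈ S) :
    (Nat.card G : ℂ)⁻¹ * ∑ g, φ g ∈ S := by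
  classical
  have hcard : ∀ g : G, Nat.card {x // ConjClasses.mk x = ConjClasses.mk g} *
      Nat.card (Subgroup.centralizer {g}) = Nat.card G := by
    -- Orbit-stabilizer for the conjugation action.
    intro g
    have h := MulAction.card_orbit_mul_card_stabilizer_eq_card_group (ConjAct G) g
    rw [Subgroup.nat_card_centralizer_nat_card_stabilizer, Nat.card_eq_fintype_card,
      Nat.card_eq_fintype_card, Nat.card_eq_fintype_card, ← ConjAct.card (G := G), ← h]
    congr 1
    refine Fintype.card_congr (Equiv.subtypeEquivRight fun x => ?_)
    rw [ConjClasses.mk_eq_mk_iff_isConj, ConjAct.mem_orbit_conjAct]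
  have hG : (Nat.card G : ℂ) ≠ 0 := by exact_mod_cast Nat.card_pos.ne'
  rw [← Finset.sum_fiberwise Finset.univ (fun g : G => ConjClasses.mk g), Finset.mul_sum]
  refine sum_mem fun K _ => ?_
  obtain ⟨g, rfl⟩ := ConjClasses.mk_surjective K
  have h1 : ∑ x with ConjClasses.mk x = ConjClasses.mk g, φ x =
      (Nat.card {x // ConjClasses.mk x = ConjClasses.mk g} : ℂ) * φ g := by
    rw [Finset.sum_congr rfl (g := fun _ => φ g), Finset.sum_const, nsmul_eq_mul,
      Nat.card_eq_fintype_card, Fintype.card_subtype]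
    intro x hx
    obtain ⟨k, hk⟩ := isConj_iff.mp
      (ConjClasses.mk_eq_mk_iff_isConj.mp (Finset.mem_filter.mp hx).2)
    rw [← hk, hφ]
  have hc : (Nat.card {x // ConjClasses.mk x = ConjClasses.mk g} : ℂ) *
      (Nat.card (Subgroup.centralizer {g}) : ℂ) = Nat.card G := by exact_mod_cast hcard g
  rw [← hc] at hG ⊢
  rw [h1, mul_inv, mul_mul_mul_comm, inv_mul_cancel₀ (left_ne_zero_of_mul hG), one_mul, mul_comm,
    ← div_eq_mul_inv]
  exact hS g

end ClassFunctions

/-! ### Integers prime to `p` are units of `𝒪` -/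

section Localisation

variable {M : Ideal AlgInt} [M.IsMaximal]

/-- A Bézout relation `1 = a p + b m` shows that `m ∈ M` would force `1 ∈ M`. -/
theorem inv_natCast_mem_valRing {p : ℕ} (hp : p.Prime) (hpM : (p : AlgInt) ∈ M) {m : ℕ}
    (hm : ¬ p ∣ m) : (m : ℂ)⁻¹ ∈ ValRing M := by
  refine ⟨1, m, fun h => one_notMem M ?_, by simp⟩
  obtain ⟨a, b, hab⟩ := Nat.isCoprime_iff_coprime.mpr (hp.coprime_iff_not_dvd.mpr hm)
  have : (1 : AlgInt) = a * p + b * m := by exact_mod_cast (congrArg (Int.cast) hab).symm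
  rw [this]
  exact M.add_mem (M.mul_mem_left _ hpM) (M.mul_mem_left _ h)

/-- Condition (int) controls only the `p`-part of the centralizer order; the remaining factor is a
unit of `𝒪`. -/
theorem div_card_centralizer_mem {p : ℕ} (hp : p.Prime) (hpM : (p : AlgInt) ∈ M)
    {G : Type*} [Group G] [Fintype G] {g : G} {z : ℂ}
    (h : IsIntegral ℤ (z / (centralizerPPart p g : ℂ))) :
    z / (Nat.card (Subgroup.centralizer {g}) : ℂ) ∈ ValRing M := by
  have h1 := Nat.ordProj_mul_ordCompl_eq_self (Nat.card (Subgroup.centralizer {g})) p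
  have h2 := Nat.not_dvd_ordCompl hp (n := Nat.card (Subgroup.centralizer {g})) Nat.card_pos.ne'
  rw [← h1, Nat.cast_mul, ← div_div, div_eq_mul_inv (_ / _)]
  exact mul_mem (mem_valRing_of_isIntegral M h) (inv_natCast_mem_valRing hp hpM h2)

end Localisation

/-! ### Isometries are signed bijections -/

section Isometries

variable {M : Ideal AlgInt} [M.IsMaximal] {G H : Type*} [Group G] [Fintype G]
  [Group H] [Fintype H]

theorem scalarProduct_sum_left {ι : Type*} (s : Finset ι) (f : ι → G → ℂ) (x : G → ℂ) :
    scalarProduct (∑ i ∈ s, f i) x = ∑ i ∈ s, scalarProduct (f i) x := by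
  simp only [scalarProduct, Finset.sum_apply, Finset.mul_sum, Finset.sum_mul]
  exact Finset.sum_comm

theorem scalarProduct_sum_right {ι : Type*} (s : Finset ι) (f : ι → G → ℂ) (x : G → ℂ) :
    scalarProduct x (∑ i ∈ s, f i) = ∑ i ∈ s, scalarProduct x (f i) := by
  simp only [scalarProduct, Finset.sum_apply, Finset.mul_sum]
  exact Finset.sum_comm

theorem scalarProduct_smul_left (c : ℂ) (x y : G → ℂ) :
    scalarProduct (c • x) y = c * scalarProduct x y := by
  simp only [scalarProduct, Pi.smul_apply, smul_eq_mul, Finset.mul_sum]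
  exact Finset.sum_congr rfl fun _ _ => by ring

theorem scalarProduct_smul_right (c : ℂ) (x y : G → ℂ) :
    scalarProduct x (c • y) = c * scalarProduct x y := by
  simp only [scalarProduct, Pi.smul_apply, smul_eq_mul, Finset.mul_sum]
  exact Finset.sum_congr rfl fun _ _ => by ring

theorem Block.exists_eq_sum_of_mem_genChar (B : Block M G) {f : G → ℂ} (hf : f ∈ B.genChar) :
    ∃ n : Irr G → ℤ, f = ∑ χ ∈ B.irr, (n χ : ℂ) • χ.1 := by
  classical
  induction hf using AddSubgroup.closure_induction with
  | mem f hf =>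
    obtain ⟨χ, hχ, rfl⟩ := hf
    refine ⟨Pi.single χ 1, ?_⟩
    rw [Finset.sum_eq_single_of_mem χ hχ fun ψ _ h => by simp [h]]
    simp
  | zero => exact ⟨0, by simp⟩
  | add f g _ _ hf hg =>
    obtain ⟨a, rfl⟩ := hf
    obtain ⟨b, rfl⟩ := hg
    exact ⟨a + b, by simp [add_smul, Finset.sum_add_distrib]⟩
  | neg f _ hf =>
    obtain ⟨a, rfl⟩ := hf
    exact ⟨-a, by simp⟩

/-- By orthonormality the norm is the sum of the squares of the integer multiplicities. If it is
`1`, exactly one multiplicity is nonzero, and that one is `±1`. -/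
theorem Block.exists_sign_of_scalarProduct_self (B : Block M G) {f : G → ℂ} (hf : f ∈ B.genChar)
    (h : scalarProduct f f = 1) :
    ∃ χ ∈ B.irr, ∃ e : ℤ, e * e = 1 ∧ f = (e : ℂ) • χ.1 := by
  classical
  obtain ⟨n, rfl⟩ := B.exists_eq_sum_of_mem_genChar hf
  have h1 : ∑ χ ∈ B.irr, n χ * n χ = 1 := by
    have : ∑ χ ∈ B.irr, (n χ : ℂ) * (n χ : ℂ) = 1 := by
      rw [← h, scalarProduct_sum_left]
      refine Finset.sum_congr rfl fun χ hχ => ?_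
      rw [scalarProduct_sum_right, Finset.sum_eq_single_of_mem χ hχ]
      · simp [scalarProduct_smul_left, scalarProduct_smul_right, scalarProduct_irr]
      · intro ψ _ hψ
        simp [scalarProduct_smul_left, scalarProduct_smul_right, scalarProduct_irr, hψ.symm]
    exact_mod_cast this
  obtain ⟨χ, hχ, hne⟩ := Finset.exists_ne_zero_of_sum_ne_zero (h1 ▸ one_ne_zero)
  have hpos : 1 ≤ n χ * n χ := by
    have := mul_self_nonneg (n χ)
    omega
  have h2 := Finset.add_sum_erase B.irr (fun χ => n χ * n χ) hχ
  have h3 : ∑ ψ ∈ B.irr.erase χ, n ψ * n ψ = 0 :=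
    le_antisymm (by omega) (Finset.sum_nonneg fun _ _ => mul_self_nonneg _)
  have h4 := (Finset.sum_eq_zero_iff_of_nonneg fun ψ _ => mul_self_nonneg (n ψ)).mp h3
  refine ⟨χ, hχ, n χ, by omega, ?_⟩
  refine Finset.sum_eq_single_of_mem χ hχ fun ψ hψ hne => ?_
  rw [mul_self_eq_zero.mp (h4 ψ (Finset.mem_erase.mpr ⟨hne, hψ⟩))]
  simp

/-- An isometry between groups of generalized characters of blocks is a signed bijection of the
irreducible characters. -/
theorem exists_signed_bijection {B : Block M G} {B' : Block M H} (I : B.genChar ≃+ B'.genChar)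
    (hI : ∀ x y, scalarProduct (I x).1 (I y).1 = scalarProduct x.1 y.1) :
    ∃ (s : B.irr ≃ B'.irr) (e : B.irr → ℂ), (∀ χ, e χ * e χ = 1) ∧
      ∀ χ : B.irr, (I ⟨χ.1.1, B.mem_genChar χ.2⟩).1 = e χ • (s χ).1.1 := by
  classical
  have key : ∀ χ : B.irr, ∃ (ψ : B'.irr) (e : ℂ), e * e = 1 ∧
      (I ⟨χ.1.1, B.mem_genChar χ.2⟩).1 = e • ψ.1.1 := by
    intro χ
    obtain ⟨ψ, hψ, e, he, h⟩ := B'.exists_sign_of_scalarProduct_self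
      (I ⟨χ.1.1, B.mem_genChar χ.2⟩).2 (by rw [hI]; simp [scalarProduct_irr])
    exact ⟨⟨ψ, hψ⟩, e, by exact_mod_cast he, h⟩
  choose s e he hs using key
  have he0 : ∀ χ, e χ ≠ 0 := fun χ h => by simpa [h] using he χ
  -- If `χ ≠ ψ` had the same image up to sign, orthogonal characters would be sent to non-orthogonal
  -- ones.
  have hinj : Function.Injective s := by
    intro χ ψ h
    by_contra hne
    have h1 := hI ⟨χ.1.1, B.mem_genChar χ.2⟩ ⟨ψ.1.1, B.mem_genChar ψ.2⟩
    rw [hs, hs, h, scalarProduct_smul_left, scalarProduct_smul_right] at h1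
    simp [scalarProduct_irr, he0, Subtype.coe_injective.ne hne] at h1
  have hsurj : Function.Surjective s := by
    intro ψ
    by_contra hψ
    -- If `s` missed `ψ`, the whole image of `I` would be orthogonal to `ψ`. But `ψ` itself lies in
    -- that image and has norm `1`.
    have h0 : ∀ x : B.genChar, scalarProduct (I x).1 ψ.1.1 = 0 := by
      rintro ⟨x, hx⟩
      induction hx using AddSubgroup.closure_induction with
      | mem x hx =>
        obtain ⟨χ, hχ, rfl⟩ := hx
        have h1 : (s ⟨χ, hχ⟩).1 ≠ ψ.1 := fun h => hψ ⟨⟨χ, hχ⟩, Subtype.ext h⟩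
        rw [hs ⟨χ, hχ⟩, scalarProduct_smul_left, scalarProduct_irr, if_neg h1, mul_zero]
      | zero =>
        rw [show (⟨0, _⟩ : B.genChar) = 0 from rfl, map_zero]
        simp [scalarProduct]
      | add x y hx hy h1 h2 =>
        rw [show (⟨x + y, _⟩ : B.genChar) = ⟨x, hx⟩ + ⟨y, hy⟩ from rfl, map_add]
        have h3 := congrArg₂ (· + ·) h1 h2
        simpa [scalarProduct, add_mul, Finset.sum_add_distrib, mul_add] using h3
      | neg x hx h1 =>
        rw [show (⟨-x, _⟩ : B.genChar) = -⟨x, hx⟩ from rfl, map_neg]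
        simpa [scalarProduct] using h1
    have h1 := h0 (I.symm ⟨ψ.1.1, B'.mem_genChar ψ.2⟩)
    rw [AddEquiv.apply_symm_apply] at h1
    simp [scalarProduct_irr] at h1
  exact ⟨Equiv.ofBijective s ⟨hinj, hsurj⟩, e, he, hs⟩

end Isometries

/-! ### Centres of corners at central idempotents -/

section Corner

variable {R A : Type*} [CommRing R] [Ring A] [Algebra R A] {e : A}

theorem isMulCentral_of_mem_center (hc : e ∈ Subalgebra.center R A) : IsMulCentral e :=
  Semigroup.mem_center_iff.mpr fun g => Subalgebra.mem_center_iff.mp hc g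

theorem mem_center_corner_iff (he : IsIdempotentElem e) (hc : e ∈ Subalgebra.center R A)
    (x : he.Corner) : x ∈ Subalgebra.center R he.Corner ↔ x.1 ∈ Subalgebra.center R A := by
  have hx := (Subsemigroup.mem_corner_iff he).mp x.2
  rw [Subalgebra.mem_center_iff, Subalgebra.mem_center_iff]
  rw [Subalgebra.mem_center_iff] at hc
  constructor
  · intro h a
    -- An arbitrary `a` is tested through its corner component `e a e`; the outer factors `e` are
    -- absorbed by `x`.
    have h1 : e * a * e * x.1 = x.1 * (e * a * e) := congrArg Subtype.val (h ⟨e * a * e, a, rfl⟩)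
    have h2 : e * a * e * x.1 = a * x.1 := by
      rw [mul_assoc, hx.1, ← hc a, mul_assoc, hx.1]
    have h3 : x.1 * (e * a * e) = x.1 * a := by
      rw [mul_assoc e, ← mul_assoc, hx.2, hc a, ← mul_assoc, hx.2]
    rw [← h2, h1, h3]
  · intro h b
    exact Subtype.ext (h b.1)

end Corner

/-! ### The centre of a block in coordinates -/

section Coordinates

variable {M : Ideal AlgInt} [M.IsMaximal] {G : Type*} [Group G] [Fintype G]

theorem mapRingHom_subtype_injective :
    Function.Injective (MonoidAlgebra.mapRingHom G (ValRing M).subtype) := by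
  intro a b h
  ext g
  simpa using congrArg (fun z => z.coeff g) h

theorem coeff_conj_of_mem_center {R : Type*} [CommRing R] {x : R[G]}
    (hx : x ∈ Subalgebra.center R R[G]) (g k : G) : x.coeff (k * g * k⁻¹) = x.coeff g := by
  have h := congrArg (fun z => z.coeff (k * g))
    (Subalgebra.mem_center_iff.mp hx (MonoidAlgebra.single k 1))
  simpa [MonoidAlgebra.coeff_single_mul_apply, MonoidAlgebra.coeff_mul_single_apply] using h.symm

theorem mapRingHom_mem_center {R S : Type*} [CommRing R] [CommRing S] (f : R →+* S) {x : R[G]}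
    (hx : x ∈ Subalgebra.center R R[G]) :
    MonoidAlgebra.mapRingHom G f x ∈ Subalgebra.center S S[G] :=
  mem_center_of_conj fun g k => by
    rw [MonoidAlgebra.coeff_mapRingHom, MonoidAlgebra.coeff_mapRingHom,
      coeff_conj_of_mem_center hx]

theorem Block.coe_mem_center (B : Block M G) (z : B.centre) :
    z.1.1 ∈ Subalgebra.center (ValRing M) (ValRing M)[G] :=
  (mem_center_corner_iff B.idem_isIdempotentElem B.idem_mem_center z.1).mp z.2

/-- An element of the centre of the block algebra, as an element of the centre of `ℂ[G]`. -/
noncomputable def Block.toComplex (B : Block M G) (z : B.centre) : Subalgebra.center ℂ ℂ[G] :=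
  ⟨MonoidAlgebra.mapRingHom G (ValRing M).subtype z.1.1,
    mapRingHom_mem_center _ (B.coe_mem_center z)⟩

/-- The values of the central characters of a block on the centre of its algebra. -/
noncomputable def Block.coords (B : Block M G) : B.centre →ₐ[ValRing M] (B.irr → ℂ) where
  toFun z χ := omegaHom χ.1 (B.toComplex z)
  map_one' := funext fun χ => by
    classical
    have h : omega χ.1 B.sumIdem = 1 := by rw [B.omega_sumIdem, if_pos χ.2]
    rw [Block.sumIdem, ← B.map_idem] at h
    exact h
  map_mul' x y := funext fun χ => by
    rw [Pi.mul_apply, ← map_mul]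
    congr 1
    exact Subtype.ext (map_mul (MonoidAlgebra.mapRingHom G (ValRing M).subtype) x.1.1 y.1.1)
  map_zero' := funext fun χ => by
    rw [Pi.zero_apply, ← map_zero (omegaHom χ.1)]
    congr 1
  map_add' x y := funext fun χ => by
    rw [Pi.add_apply, ← map_add]
    congr 1
    exact Subtype.ext (map_add (MonoidAlgebra.mapRingHom G (ValRing M).subtype) x.1.1 y.1.1)
  commutes' r := funext fun χ => by
    classical
    have h : omega χ.1 B.sumIdem = 1 := by rw [B.omega_sumIdem, if_pos χ.2]
    rw [Block.sumIdem, ← B.map_idem] at h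
    change omega χ.1 (MonoidAlgebra.mapRingHom G (ValRing M).subtype (r • B.idem)) = (r : ℂ)
    rw [← mul_one (r : ℂ), ← h]
    simp [omega, ← mul_div_assoc, Finset.mul_sum, mul_assoc]

/-- Central elements of `ℂG` agree when all central characters agree on them (`eq_zero_of_omega`).
For `ψ` in the block this is `ω_ψ(e_χ) = δ`; for the other `ψ` both sides give zero. -/
theorem Block.toComplex_eq_sum (B : Block M G) (z : B.centre) :
    (B.toComplex z : ℂ[G]) = ∑ χ : B.irr, B.coords z χ • centralIdem χ.1 := by
  classical
  let y : Subalgebra.center ℂ ℂ[G] :=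
    ∑ χ : B.irr, algebraMap ℂ _ (B.coords z χ) * ⟨centralIdem χ.1, centralIdem_mem_center χ.1⟩
  have hy : (y : ℂ[G]) = ∑ χ : B.irr, B.coords z χ • centralIdem χ.1 := by
    simp [y, Algebra.smul_def]
  rw [← hy, ← sub_eq_zero]
  refine eq_zero_of_omega (B.toComplex z - y).2 fun ψ => ?_
  change omegaHom ψ (B.toComplex z - y) = 0
  have h1 : ∀ χ : B.irr, omegaHom ψ ⟨centralIdem χ.1, centralIdem_mem_center χ.1⟩ =
      if ψ = χ.1 then 1 else 0 := fun χ => omega_centralIdem χ.1 ψ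
  rw [map_sub, sub_eq_zero, map_sum]
  simp only [map_mul, omegaHom_algebraMap, h1]
  by_cases hψ : ψ ∈ B.irr
  · rw [Finset.sum_eq_single (⟨ψ, hψ⟩ : B.irr)]
    · rw [if_pos rfl, mul_one]
      rfl
    · intro χ _ hne
      rw [if_neg fun h => hne (Subtype.ext h.symm), mul_zero]
    · simp
  · rw [Finset.sum_eq_zero fun χ _ => by
      rw [if_neg fun h : ψ = χ.1 => hψ (h ▸ χ.2), mul_zero]]
    -- Outside the block, `z = f_B z` and `ω_ψ(f_B) = 0`.
    have h2 : B.toComplex z = ⟨B.sumIdem, B.sumIdem_mem_center⟩ * B.toComplex z := by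
      apply Subtype.ext
      change MonoidAlgebra.mapRingHom G (ValRing M).subtype z.1.1 =
        B.sumIdem * MonoidAlgebra.mapRingHom G (ValRing M).subtype z.1.1
      rw [Block.sumIdem, ← B.map_idem, ← map_mul,
        ((Subsemigroup.mem_corner_iff B.idem_isIdempotentElem).mp z.1.2).1]
    have h3 : omegaHom ψ ⟨B.sumIdem, B.sumIdem_mem_center⟩ = 0 := by
      rw [← if_neg (c := ψ ∈ B.irr) (t := (1 : ℂ)) (e := 0) hψ]
      exact B.omega_sumIdem ψ
    rw [h2, map_mul, h3, zero_mul]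

theorem Block.coords_injective (B : Block M G) : Function.Injective B.coords := by
  intro x y h
  have h1 : (B.toComplex x : ℂ[G]) = B.toComplex y := by
    rw [B.toComplex_eq_sum, B.toComplex_eq_sum, h]
  exact Subtype.ext (Subtype.ext (mapRingHom_subtype_injective h1))

/-- The class function `∑ v_χ (χ(1) / |G|) χ` on `G`. -/
noncomputable def Block.classFun (B : Block M G) (v : B.irr → ℂ) (g : G) : ℂ :=
  ∑ χ : B.irr, v χ * (χ.1 1 / (Nat.card G : ℂ)) * χ.1 g

theorem Block.classFun_conj (B : Block M G) (v : B.irr → ℂ) (g k : G) :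
    B.classFun v (k * g * k⁻¹) = B.classFun v g := by
  simp only [Block.classFun, irr_conj]

theorem coeff_sum_smul_centralIdem (B : Block M G) (v : B.irr → ℂ) (g : G) :
    (∑ χ : B.irr, v χ • centralIdem χ.1).coeff g = B.classFun v g⁻¹ := by
  simp [Finsupp.finsetSum_apply, coeff_centralIdem, Block.classFun, mul_assoc]

/-- The coefficient of `∑ v_χ e_χ` at `g` is the value of the class function at `g⁻¹`, so the
criterion says that this element has coefficients in `𝒪`. Centrality, and membership in the block,
are then automatic. -/
theorem Block.mem_range_coords_iff (B : Block M G) (v : B.irr → ℂ) :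
    v ∈ B.coords.range ↔ ∀ g, B.classFun v g ∈ ValRing M := by
  classical
  constructor
  · rintro ⟨z, rfl⟩ g
    have h := coeff_sum_smul_centralIdem B (B.coords z) g⁻¹
    rw [← B.toComplex_eq_sum, inv_inv] at h
    change _ = B.classFun (B.coords z) g at h
    change B.classFun (B.coords z) g ∈ _
    rw [← h]
    exact (mem_range_iff _).mp ⟨z.1.1, rfl⟩ g⁻¹
  · intro h
    obtain ⟨x, hx⟩ := (mem_range_iff (M := M) (∑ χ : B.irr, v χ • centralIdem χ.1)).mpr
      fun g => by rw [coeff_sum_smul_centralIdem]; exact h _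
    have hxc : x ∈ Subalgebra.center (ValRing M) (ValRing M)[G] := by
      refine mem_center_of_conj fun g k => Subtype.ext ?_
      have hg : ∀ g, (x.coeff g : ℂ) = B.classFun v g⁻¹ := fun g => by
        rw [← coeff_sum_smul_centralIdem, ← hx, MonoidAlgebra.coeff_mapRingHom]
        rfl
      rw [hg, hg, ← B.classFun_conj v g⁻¹ k]
      simp only [mul_inv_rev, inv_inv, mul_assoc]
    have hom : ∀ ψ : Irr G, omega ψ (∑ χ : B.irr, v χ • centralIdem χ.1) =
        ∑ χ : B.irr, v χ * if ψ = χ.1 then 1 else 0 := by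
      intro ψ
      have : (∑ χ : B.irr, v χ • centralIdem χ.1 : ℂ[G]) = ((∑ χ : B.irr, algebraMap ℂ _ (v χ) *
          ⟨centralIdem χ.1, centralIdem_mem_center χ.1⟩ : Subalgebra.center ℂ ℂ[G]) : ℂ[G]) := by
        simp [Algebra.smul_def]
      rw [this]
      change omegaHom ψ _ = _
      rw [map_sum]
      simp only [map_mul, omegaHom_algebraMap]
      exact Finset.sum_congr rfl fun χ _ => congrArg _ (omega_centralIdem χ.1 ψ)
    -- Checked on central characters: those in the block take the value `1` on `f_B`, the others
    -- vanish on `x`.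
    have hxe : B.idem * x = x := by
      apply mapRingHom_subtype_injective
      rw [map_mul, B.map_idem, ← sub_eq_zero]
      let e : Subalgebra.center ℂ ℂ[G] := ⟨B.sumIdem, B.sumIdem_mem_center⟩
      let y : Subalgebra.center ℂ ℂ[G] := ⟨_, mapRingHom_mem_center (ValRing M).subtype hxc⟩
      refine eq_zero_of_omega (e * y - y).2 fun ψ => ?_
      change omegaHom ψ (e * y - y) = 0
      have he : omegaHom ψ e = if ψ ∈ B.irr then 1 else 0 := B.omega_sumIdem ψ
      have hy : omegaHom ψ y = ∑ χ : B.irr, v χ * if ψ = χ.1 then 1 else 0 := by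
        rw [← hom, ← hx]
        rfl
      rw [map_sub, map_mul, he]
      split_ifs with hψ
      · ring
      · rw [hy, Finset.sum_eq_zero fun χ _ => by
      rw [if_neg fun h : ψ = χ.1 => hψ (h ▸ χ.2), mul_zero]]
        ring
    have hxm : x ∈ Subsemigroup.corner B.idem :=
      (Subsemigroup.mem_corner_iff_mul_left B.idem_isIdempotentElem
        (isMulCentral_of_mem_center B.idem_mem_center)).mpr hxe
    refine ⟨⟨⟨x, hxm⟩, (mem_center_corner_iff B.idem_isIdempotentElem B.idem_mem_center _).mpr
      hxc⟩, funext fun ψ => ?_⟩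
    change omega ψ.1 (MonoidAlgebra.mapRingHom G (ValRing M).subtype x) = v ψ
    have hx' : MonoidAlgebra.mapRingHom G (ValRing M).subtype x =
      ∑ χ : B.irr, v χ • centralIdem χ.1 := hx
    rw [hx', hom, Finset.sum_eq_single ψ]
    · simp
    · intro χ _ hne
      rw [if_neg fun h => hne (Subtype.ext h.symm), mul_zero]
    · simp

end Coordinates

/-! ### Transfer along a signed bijection -/

section Transfer

variable {M : Ideal AlgInt} [M.IsMaximal] {G H : Type*} [Group G] [Fintype G]
  [Group H] [Fintype H] {B : Block M G} {B' : Block M H}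

/-- The function `∑ e_χ χ(g) s(χ)(h)` attached to a signed bijection `(s, e)`. -/
noncomputable def signedMu (s : B.irr ≃ B'.irr) (e : B.irr → ℂ) (g : G) (h : H) : ℂ :=
  ∑ χ : B.irr, e χ * χ.1 g * (s χ).1 h

/-- Makes every statement about `(s, e)` available for the inverse isometry, with the two
integrality conditions interchanged. -/
theorem signedMu_symm (s : B.irr ≃ B'.irr) (e : B.irr → ℂ) (g : G) (h : H) :
    signedMu s.symm (e ∘ s.symm) h g = signedMu s e g h := by
  rw [signedMu, signedMu, ← Equiv.sum_comp s]
  refine Finset.sum_congr rfl fun χ _ => ?_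
  simp only [Function.comp_apply, Equiv.symm_apply_apply]
  ring

/-- Orthonormality of characters: averaging against `μ(g⁻¹, h)` replaces each `χ` by `e_χ s(χ)`. -/
theorem card_inv_mul_sum_signedMu (s : B.irr ≃ B'.irr) (e : B.irr → ℂ) (v : B.irr → ℂ) (h : H) :
    (Nat.card G : ℂ)⁻¹ * ∑ g, signedMu s e g⁻¹ h * B.classFun v g =
      ∑ χ : B.irr, e χ * (v χ * (χ.1 1 / (Nat.card G : ℂ))) * (s χ).1 h := by
  classical
  have h1 : (Nat.card G : ℂ)⁻¹ * ∑ g, signedMu s e g⁻¹ h * B.classFun v g =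
      ∑ χ : B.irr, ∑ ψ : B.irr, e χ * (v ψ * (ψ.1 1 / (Nat.card G : ℂ))) * (s χ).1 h *
        scalarProduct ψ.1.1 χ.1.1 := by
    simp only [signedMu, Block.classFun, scalarProduct, Finset.sum_mul_sum]
    simp only [Finset.mul_sum]
    rw [Finset.sum_comm]
    refine Finset.sum_congr rfl fun χ _ => ?_
    rw [Finset.sum_comm]
    refine Finset.sum_congr rfl fun ψ _ => Finset.sum_congr rfl fun g _ => ?_
    ring
  rw [h1]
  refine Finset.sum_congr rfl fun χ _ => ?_
  rw [Finset.sum_eq_single χ]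
  · rw [scalarProduct_irr, if_pos rfl, mul_one]
  · intro ψ _ hne
    rw [scalarProduct_irr, if_neg fun h => hne (Subtype.ext h), mul_zero]
  · simp

theorem irr_one_div_card_ne_zero (χ : Irr G) : χ 1 / (Nat.card G : ℂ) ≠ 0 :=
  div_ne_zero (irr_one_ne_zero χ) (by exact_mod_cast Nat.card_pos.ne')

/-- The map of class functions defined by `(s, e)` preserves integrality. -/
theorem transfer_mem_range (s : B.irr ≃ B'.irr) (e : B.irr → ℂ)
    (hint : ∀ g h, signedMu s e g h / (Nat.card (Subgroup.centralizer {g}) : ℂ) ∈ ValRing M)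
    {v : B.irr → ℂ} (hv : v ∈ B.coords.range) :
    (fun ψ : B'.irr => e (s.symm ψ) * (v (s.symm ψ) * ((s.symm ψ).1 1 / (Nat.card G : ℂ))) /
      (ψ.1 1 / (Nat.card H : ℂ))) ∈ B'.coords.range := by
  rw [Block.mem_range_coords_iff] at hv ⊢
  intro h
  have h1 : B'.classFun (fun ψ : B'.irr => e (s.symm ψ) *
      (v (s.symm ψ) * ((s.symm ψ).1 1 / (Nat.card G : ℂ))) / (ψ.1 1 / (Nat.card H : ℂ))) h =
      ∑ χ : B.irr, e χ * (v χ * (χ.1 1 / (Nat.card G : ℂ))) * (s χ).1 h := by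
    rw [Block.classFun, ← Equiv.sum_comp s]
    refine Finset.sum_congr rfl fun χ _ => ?_
    rw [Equiv.symm_apply_apply, div_mul_cancel₀ _ (irr_one_div_card_ne_zero _)]
  rw [h1, ← card_inv_mul_sum_signedMu]
  refine sum_div_card_mem _ (fun g k => ?_) fun g => ?_
  · have : (k * g * k⁻¹)⁻¹ = k * g⁻¹ * k⁻¹ := by group
    simp only [this, Block.classFun_conj, signedMu, irr_conj]
  -- `μ` is evaluated at `g⁻¹`, whose centralizer is that of `g`; the class function contributes a
  -- factor in `𝒪`.
  · rw [mul_div_right_comm, ← centralizer_inv_singleton]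
    exact mul_mem (hint _ _) (hv g)

/-- The transfer rescales coordinates, and the rescaling is undone by a factor that itself belongs
to the centre. That factor is the reverse transfer of `1`, which is why integrality is needed on
both sides. -/
theorem comp_symm_mem_range (s : B.irr ≃ B'.irr) (e : B.irr → ℂ) (he : ∀ χ, e χ * e χ = 1)
    (hl : ∀ g h, signedMu s e g h / (Nat.card (Subgroup.centralizer {g}) : ℂ) ∈ ValRing M)
    (hr : ∀ g h, signedMu s e g h / (Nat.card (Subgroup.centralizer {h}) : ℂ) ∈ ValRing M)
    {v : B.irr → ℂ} (hv : v ∈ B.coords.range) : v ∘ s.symm ∈ B'.coords.range := by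
  -- The element with coordinates `e_χ (s(χ)(1)/|H|)/(χ(1)/|G|)`. Multiplied by `v` and transferred
  -- forward, it leaves `e_χ² v_χ = v_χ` at `s(χ)`.
  have h1 := transfer_mem_range s.symm (e ∘ s.symm)
    (fun h g => by rw [signedMu_symm]; exact hr g h) (one_mem B'.coords.range)
  have h2 := transfer_mem_range s e hl (mul_mem h1 hv)
  convert h2 using 1
  funext ψ
  have h3 := irr_one_div_card_ne_zero (s.symm ψ).1
  have h4 := irr_one_div_card_ne_zero ψ.1
  simp only [Function.comp_apply, Pi.mul_apply, Pi.one_apply, Equiv.symm_symm,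
    Equiv.apply_symm_apply, Equiv.symm_apply_apply, one_mul]
  rw [eq_div_iff h4, div_mul_eq_mul_div, div_mul_cancel₀ _ h3, mul_assoc, ← mul_assoc, ← mul_assoc,
    he, one_mul, mul_comm]

/-- A signed bijection that satisfies the integrality conditions induces an isomorphism of the
centres of the block algebras over `𝒪`. -/
theorem nonempty_centre_algEquiv (s : B.irr ≃ B'.irr) (e : B.irr → ℂ) (he : ∀ χ, e χ * e χ = 1)
    (hl : ∀ g h, signedMu s e g h / (Nat.card (Subgroup.centralizer {g}) : ℂ) ∈ ValRing M)
    (hr : ∀ g h, signedMu s e g h / (Nat.card (Subgroup.centralizer {h}) : ℂ) ∈ ValRing M) :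
    Nonempty (B.centre ≃ₐ[ValRing M] B'.centre) := by
  -- Relabelling coordinates along `s` is an algebra map, so it remains only to match the two images
  -- inside `Irr(B') → ℂ`.
  let r : (B.irr → ℂ) →ₐ[ValRing M] (B'.irr → ℂ) :=
    AlgHom.pi fun ψ => Pi.evalAlgHom (ValRing M) (fun _ : B.irr => ℂ) (s.symm ψ)
  have hr' : ∀ v, r v = v ∘ s.symm := fun v => rfl
  have hinj : Function.Injective (r.comp B.coords) :=
    (s.symm.surjective.injective_comp_right (γ := ℂ)).comp B.coords_injective
  have hrange : (r.comp B.coords).range = B'.coords.range := by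
    ext u
    constructor
    · rintro ⟨z, rfl⟩
      exact comp_symm_mem_range s e he hl hr ⟨z, rfl⟩
    · intro hu
      obtain ⟨z, hz⟩ := comp_symm_mem_range s.symm (e ∘ s.symm) (fun _ => he _)
        (fun h g => by rw [signedMu_symm]; exact hr g h)
        (fun h g => by rw [signedMu_symm]; exact hl g h) hu
      refine ⟨z, ?_⟩
      change r (B.coords z) = u
      have hz' : B.coords z = u ∘ s := hz
      rw [hr', hz', Function.comp_assoc, Equiv.self_comp_symm, Function.comp_id]
  exact ⟨(AlgEquiv.ofInjective _ hinj).trans ((Subalgebra.equivOfEq _ _ hrange).trans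
    (AlgEquiv.ofInjective _ B'.coords_injective).symm)⟩

end Transfer

/-! ### Isomorphisms induced on quotients -/

section Quotients

/-- An isomorphism of algebras that is compatible with the kernels of two surjections induces an
isomorphism of their images. -/
theorem nonempty_algEquiv_of_surjective {O F Z Z' Y Y' : Type*} [CommSemiring O]
    [CommSemiring F] [Semiring Z] [Semiring Z'] [Semiring Y] [Semiring Y'] [Algebra O Z]
    [Algebra O Z'] [Algebra F Y] [Algebra F Y'] {π : O →+* F} (hπ : Function.Surjective π)
    (φ : Z ≃ₐ[O] Z') {r : Z →+* Y} {r' : Z' →+* Y'} (hr : Function.Surjective r)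
    (hr' : Function.Surjective r') (hs : ∀ a z, r (a • z) = π a • r z)
    (hs' : ∀ a z, r' (a • z) = π a • r' z) (hφ : ∀ x y, r x = r y ↔ r' (φ x) = r' (φ y)) :
    Nonempty (Y ≃ₐ[F] Y') := by
  -- By `hφ` the value does not depend on the chosen preimage.
  let f : Y → Y' := fun y => r' (φ (Function.surjInv hr y))
  have hf : ∀ z, f (r z) = r' (φ z) := fun z => (hφ _ _).mp (Function.surjInv_eq hr (r z))
  let e : Y →ₐ[F] Y' :=
    { toFun := f
      map_one' := by rw [← map_one r, hf, map_one, map_one]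
      map_mul' := fun x y => by
        obtain ⟨x, rfl⟩ := hr x
        obtain ⟨y, rfl⟩ := hr y
        rw [← map_mul, hf, hf, hf, map_mul, map_mul]
      map_zero' := by rw [← map_zero r, hf, map_zero, map_zero]
      map_add' := fun x y => by
        obtain ⟨x, rfl⟩ := hr x
        obtain ⟨y, rfl⟩ := hr y
        rw [← map_add, hf, hf, hf, map_add, map_add]
      commutes' := fun y => by
        obtain ⟨a, rfl⟩ := hπ y
        rw [Algebra.algebraMap_eq_smul_one, Algebra.algebraMap_eq_smul_one, ← map_one r, ← hs,
          hf, map_smul, map_one, hs', map_one] }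
  refine ⟨AlgEquiv.ofBijective e ⟨fun x y h => ?_, fun y => ?_⟩⟩
  · obtain ⟨x, rfl⟩ := hr x
    obtain ⟨y, rfl⟩ := hr y
    exact (hφ x y).mpr ((hf x).symm.trans (h.trans (hf y)))
  · obtain ⟨z, rfl⟩ := hr' y
    exact ⟨r (φ.symm z), (hf _).trans (by rw [φ.apply_symm_apply])⟩

theorem map_sum_smul_eq_zero {O F Z Y ι : Type*} [CommSemiring O] [CommSemiring F] [Semiring Z]
    [Semiring Y] [Algebra O Z] [Algebra F Y] {π : O →+* F} {r : Z →+* Y}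
    (hs : ∀ a z, r (a • z) = π a • r z) (s : Finset ι) (a : ι → O) (c : ι → Z)
    (ha : ∀ i, π (a i) = 0) : r (∑ i ∈ s, a i • c i) = 0 := by
  rw [map_sum]
  exact Finset.sum_eq_zero fun i _ => by rw [hs, ha, zero_smul]

theorem mapRingHom_smul {O F G : Type*} [CommRing O] [CommRing F] [Group G] (π : O →+* F) (a : O)
    (x : O[G]) : MonoidAlgebra.mapRingHom G π (a • x) = π a • MonoidAlgebra.mapRingHom G π x := by
  ext g
  simp

end Quotients

/-! ### Reduction from `𝒪` to `F` -/

section Reduction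

variable {M : Ideal AlgInt} [M.IsMaximal] {G H : Type*} [Group G] [Fintype G]
  [Group H] [Fintype H] (B : Block M G) (B' : Block M H)

theorem residue_surjective : Function.Surjective (residue M) := by
  intro y
  obtain ⟨r, rfl⟩ := Ideal.Quotient.mk_surjective y
  refine ⟨⟨r, mem_valRing_of_isIntegral M r.2⟩, ?_⟩
  have h := residueFun_mul M ⟨r, mem_valRing_of_isIntegral M r.2⟩ r 1 (one_notMem M) (by simp)
  rwa [map_one, mul_one] at h

/-- Reduction of coefficients, from the centre of the block algebra over `𝒪` to the one
over `F`. -/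
noncomputable def Block.reduce : B.centre →+* B.centreF where
  toFun z := ⟨⟨MonoidAlgebra.mapRingHom G (residue M) z.1.1,
      (Subsemigroup.mem_corner_iff B.idemF_isIdempotentElem).mpr (by
        have h := (Subsemigroup.mem_corner_iff B.idem_isIdempotentElem).mp z.1.2
        rw [Block.idemF, ← map_mul, ← map_mul, h.1, h.2]
        exact ⟨rfl, rfl⟩)⟩,
    (mem_center_corner_iff B.idemF_isIdempotentElem B.idemF_mem_center _).mpr
      (mapRingHom_mem_center _ (B.coe_mem_center z))⟩
  map_one' := rfl
  map_mul' x y := Subtype.ext <| Subtype.ext <|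
    map_mul (MonoidAlgebra.mapRingHom G (residue M)) x.1.1 y.1.1
  map_zero' := Subtype.ext <| Subtype.ext <| map_zero (MonoidAlgebra.mapRingHom G (residue M))
  map_add' x y := Subtype.ext <| Subtype.ext <|
    map_add (MonoidAlgebra.mapRingHom G (residue M)) x.1.1 y.1.1

theorem Block.reduce_smul (a : ValRing M) (z : B.centre) :
    B.reduce (a • z) = residue M a • B.reduce z := by
  exact Subtype.ext (Subtype.ext (mapRingHom_smul (residue M) a z.1.1))

/-- The component in the block algebra of a central element of `𝒪[G]`. -/
noncomputable def Block.component (x : (ValRing M)[G])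
    (hx : x ∈ Subalgebra.center (ValRing M) (ValRing M)[G]) : B.centre :=
  ⟨⟨B.idem * x, (Subsemigroup.mem_corner_iff_mul_left B.idem_isIdempotentElem
      (isMulCentral_of_mem_center B.idem_mem_center)).mpr
        (by rw [← mul_assoc, B.idem_isIdempotentElem.eq])⟩,
    (mem_center_corner_iff B.idem_isIdempotentElem B.idem_mem_center _).mpr
      (mul_mem B.idem_mem_center hx)⟩

/-- Lifting coefficients by one fixed section of `𝒪 → F` keeps them constant on conjugacy classes,
so the lift is central. Multiplication by `f_B` brings it into the block and does not change its
reduction. -/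
theorem Block.reduce_surjective : Function.Surjective B.reduce := by
  intro y
  classical
  choose t ht using residue_surjective (M := M)
  have hy := (mem_center_corner_iff B.idemF_isIdempotentElem B.idemF_mem_center y.1).mp y.2
  let x : (ValRing M)[G] := ∑ g, MonoidAlgebra.single g (t (y.1.1.coeff g))
  have hx : ∀ g, x.coeff g = t (y.1.1.coeff g) := fun g => by
    simp [x, Finsupp.finsetSum_apply, Finsupp.single_apply]
  have hxc : x ∈ Subalgebra.center (ValRing M) (ValRing M)[G] :=
    mem_center_of_conj fun g k => by rw [hx, hx, coeff_conj_of_mem_center hy]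
  refine ⟨B.component x hxc, Subtype.ext (Subtype.ext ?_)⟩
  change MonoidAlgebra.mapRingHom G (residue M) (B.idem * x) = y.1.1
  have hxy : MonoidAlgebra.mapRingHom G (residue M) x = y.1.1 := by
    ext g
    rw [MonoidAlgebra.coeff_mapRingHom, hx, ht]
  rw [map_mul, hxy]
  exact ((Subsemigroup.mem_corner_iff B.idemF_isIdempotentElem).mp y.1.2).1

/-- The inclusion of the centre of the block algebra in `𝒪[G]`. -/
def Block.inclusion : B.centre →ₗ[ValRing M] (ValRing M)[G] where
  toFun z := z.1.1
  map_add' _ _ := rfl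
  map_smul' _ _ := rfl

/-- The kernel of reduction is generated by the maximal ideal of `𝒪`. -/
theorem Block.exists_eq_sum_of_residue_eq_zero {z : B.centre}
    (hz : ∀ g, residue M (z.1.1.coeff g) = 0) :
    ∃ (a : ConjClasses G → ValRing M) (c : ConjClasses G → B.centre),
      (∀ K, residue M (a K) = 0) ∧ z = ∑ᶠ K, a K • c K := by
  classical
  have : Fintype (ConjClasses G) := Fintype.ofFinite _
  let k : ConjClasses G → (ValRing M)[G] := fun K =>
    ∑ x with ConjClasses.mk x = K, MonoidAlgebra.single x 1
  have hk : ∀ K g, (k K).coeff g = if ConjClasses.mk g = K then 1 else 0 := by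
    intro K g
    simp [k, Finsupp.finsetSum_apply, Finsupp.single_apply]
  have hkc : ∀ K, k K ∈ Subalgebra.center (ValRing M) (ValRing M)[G] := fun K =>
    mem_center_of_conj fun g x => by
      rw [hk, hk, ConjClasses.mk_eq_mk_iff_isConj.mpr (isConj_iff.mpr ⟨x, rfl⟩ : IsConj g _)]
  -- Since `z` is central, it is the combination of class sums with its own coefficients. Then `z =
  -- f_B z` replaces each class sum by its block component.
  refine ⟨fun K => z.1.1.coeff K.out, fun K => B.component (k K) (hkc K), fun K => hz _, ?_⟩
  rw [finsum_eq_sum_of_fintype]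
  have hinj : Function.Injective B.inclusion := fun x y h => Subtype.ext (Subtype.ext h)
  apply hinj
  rw [map_sum]
  change z.1.1 = ∑ K : ConjClasses G, z.1.1.coeff K.out • (B.idem * k K)
  simp only [← mul_smul_comm, ← Finset.mul_sum]
  have hsum : ∑ K : ConjClasses G, z.1.1.coeff K.out • k K = z.1.1 := by
    ext g
    have hg : z.1.1.coeff (ConjClasses.mk g).out = z.1.1.coeff g := by
      obtain ⟨x, hx⟩ := isConj_iff.mp (ConjClasses.mk_eq_mk_iff_isConj.mp
        (Quotient.out_eq (ConjClasses.mk g)).symm)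
      rw [← hx, coeff_conj_of_mem_center (B.coe_mem_center z)]
    simp [Finsupp.finsetSum_apply, hk, hg]
  rw [hsum]
  exact ((Subsemigroup.mem_corner_iff B.idem_isIdempotentElem).mp z.1.2).1.symm

variable {B B'}

/-- The difference of `x` and `y` is a combination of central elements with scalars that reduce to
zero. An `𝒪`-linear map preserves this form. -/
theorem Block.reduce_map_eq (φ : B.centre →ₐ[ValRing M] B'.centre) {x y : B.centre}
    (h : B.reduce x = B.reduce y) : B'.reduce (φ x) = B'.reduce (φ y) := by
  have : Fintype (ConjClasses G) := Fintype.ofFinite _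
  have hz : ∀ g, residue M ((x + (-1 : ValRing M) • y).1.1.coeff g) = 0 := fun g => by
    have h1 : MonoidAlgebra.mapRingHom G (residue M) x.1.1 =
        MonoidAlgebra.mapRingHom G (residue M) y.1.1 := congrArg (fun u : B.centreF => u.1.1) h
    have h2 := congrArg (fun u => u.coeff g) h1
    simp only [MonoidAlgebra.coeff_mapRingHom] at h2
    change residue M ((x.1.1 + (-1 : ValRing M) • y.1.1).coeff g) = 0
    rw [MonoidAlgebra.coeff_add, MonoidAlgebra.coeff_smul, Finsupp.add_apply, Finsupp.smul_apply,
      smul_eq_mul, neg_one_mul, map_add, map_neg, h2, add_neg_cancel]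
  obtain ⟨a, c, ha, hac⟩ := B.exists_eq_sum_of_residue_eq_zero hz
  have hx : x = (∑ K, a K • c K) + y := by
    rw [← finsum_eq_sum_of_fintype, ← hac]
    refine Subtype.ext (Subtype.ext ?_)
    change x.1.1 = x.1.1 + (-1 : ValRing M) • y.1.1 + y.1.1
    rw [neg_one_smul, neg_add_cancel_right]
  have h0 : B'.reduce (φ (∑ K, a K • c K)) = 0 := by
    rw [map_sum φ]
    simp only [map_smul φ]
    exact map_sum_smul_eq_zero B'.reduce_smul _ _ _ ha
  rw [hx, map_add φ, B'.reduce.map_add, h0, zero_add]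

/-- An isomorphism of centres over `𝒪` reduces to one over `F`. -/
theorem nonempty_centreF_algEquiv (φ : B.centre ≃ₐ[ValRing M] B'.centre) :
    Nonempty (B.centreF ≃ₐ[ResField M] B'.centreF) :=
  nonempty_algEquiv_of_surjective residue_surjective φ B.reduce_surjective
    B'.reduce_surjective B.reduce_smul B'.reduce_smul fun x y =>
    ⟨fun h => Block.reduce_map_eq φ.toAlgHom h, fun h => by
      have h1 : B.reduce (φ.symm (φ x)) = B.reduce (φ.symm (φ y)) :=
        Block.reduce_map_eq φ.symm.toAlgHom h
      rwa [φ.symm_apply_apply, φ.symm_apply_apply] at h1⟩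

end Reduction

end PerfectIsometry

theorem mainTheorem8 {p : ℕ} (hp : p.Prime)
    (M : Ideal PerfectIsometry.AlgInt) [M.IsMaximal] (hpM : (p : PerfectIsometry.AlgInt) ∈ M)
    {G : Type*} [Group G] [Fintype G] {H : Type*} [Group H] [Fintype H]
    (B : PerfectIsometry.Block M G) (B' : PerfectIsometry.Block M H)
    (hBB' : PerfectIsometry.PerfectlyIsometric p B B') :
    Nonempty (B.centre ≃ₐ[PerfectIsometry.ValRing M] B'.centre) ∧
      Nonempty (B.centreF ≃ₐ[PerfectIsometry.ResField M] B'.centreF) := by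
  obtain ⟨I, hI⟩ := hBB'
  obtain ⟨s, e, he, hs⟩ := PerfectIsometry.exists_signed_bijection I hI.isometry
  -- Substituting `I(χ) = e_χ s(χ)` expresses the integrality conditions in terms of `(s, e)`.
  have hmu : ∀ g h, PerfectIsometry.mu I g h = PerfectIsometry.signedMu s e g h := by
    intro g h
    refine Finset.sum_congr rfl fun χ _ => ?_
    rw [hs, Pi.smul_apply, smul_eq_mul]
    ring
  obtain ⟨φ⟩ := PerfectIsometry.nonempty_centre_algEquiv s e he
    (fun g h => PerfectIsometry.div_card_centralizer_mem hp hpM (hmu g h ▸ hI.int_left g h))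
    (fun g h => PerfectIsometry.div_card_centralizer_mem hp hpM (hmu g h ▸ hI.int_right g h))
  exact ⟨⟨φ⟩, PerfectIsometry.nonempty_centreF_algEquiv φ⟩
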